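/- For a prime $p$ and finite sets $B,C\subseteq\mathbb F_p$ write $$E_+(B)=\#\{(b_1,b_2,b_3,b_4)\in B^4: b_1+b_2=b_3+b_4\},\qquad E_\times(C)=\#\{(c_1,c_2,c_3,c_4)\in C^4: c_1c_2=c_3c_4\}.$$ There exist absolute constants $K>0$ and $p_0$ such that for every prime $p\ge p_0$ and every $A\subseteq\mathbb F_p$ the following hold. (i) If $|A|\ge 2$ and $|A|<\sqrt p$, then, with $\delta=4/227$, there exist disjoint subsets $B$ and $C$ of $A$ with $A=B\cup C$ and $$\max\{E_+(B),E_\times(C)\}\le K\,|A|^{3-\delta}(\log|A|)^{1+\delta/2}.$$ (ii) If $|A|\ge\sqrt p$, then, with $\delta=4/283$ and $\theta=223/249$, there exist disjoint subsets $B$ and $C$ of $A$ with $A=B\cup C$ and $$\max\{E_+(B),E_\times(C)\}\le K\,|A|^{3}\left(\frac{|A|}{p}\right)^{\delta}(\log|A|)^{\theta}.$$ -/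

import Mathlib

section LowEnergyDecomposition

open Finset
open scoped Pointwise

section Energy

variable {α β γ ι : Type*} [DecidableEq γ]

lemma card_filter_eq_sum_mul_fibers (P : Finset α) (Q : Finset β) (f : α → γ) (g : β → γ)
    (V : Finset γ) (hV : ∀ x ∈ P, f x ∈ V) :
    #{x ∈ P ×ˢ Q | f x.1 = g x.2} = ∑ c ∈ V, #{x ∈ P | f x = c} * #{y ∈ Q | g y = c} := by
  rw [card_eq_sum_card_fiberwise (f := fun x : α × β => f x.1) (t := V)]
  · refine sum_congr rfl fun c _ => ?_
    rw [← card_product]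
    congr 1
    ext ⟨x, y⟩
    simp only [mem_filter, mem_product]
    constructor
    · rintro ⟨⟨⟨h1, h2⟩, h3⟩, h4⟩
      exact ⟨⟨h1, h4⟩, h2, h3 ▸ h4⟩
    · rintro ⟨⟨h1, h2⟩, h3, h4⟩
      exact ⟨⟨⟨h1, h3⟩, h2.trans h4.symm⟩, h2⟩
  · intro x hx
    simp only [coe_filter, mem_product, Set.mem_ofPred_eq] at hx
    exact hV _ hx.1.1

lemma two_mul_card_cross_le (P : Finset α) (Q : Finset β) (f : α → γ) (g : β → γ) :
    2 * #{x ∈ P ×ˢ Q | f x.1 = g x.2} ≤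
      #{x ∈ P ×ˢ P | f x.1 = f x.2} + #{x ∈ Q ×ˢ Q | g x.1 = g x.2} := by
  have hP : ∀ x ∈ P, f x ∈ P.image f ∪ Q.image g := fun x hx =>
    mem_union_left _ (mem_image_of_mem _ hx)
  have hQ : ∀ x ∈ Q, g x ∈ P.image f ∪ Q.image g := fun x hx =>
    mem_union_right _ (mem_image_of_mem _ hx)
  rw [card_filter_eq_sum_mul_fibers P Q f g _ hP, card_filter_eq_sum_mul_fibers P P f f _ hP,
    card_filter_eq_sum_mul_fibers Q Q g g _ hQ, mul_sum, ← sum_add_distrib]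
  refine sum_le_sum fun c _ => ?_
  nlinarith [two_mul_le_add_sq (#{x ∈ P | f x = c}) (#{x ∈ Q | g x = c})]

variable [DecidableEq α]

lemma card_collisions_biUnion_le (s : Finset ι) (P : ι → Finset α) (f : α → γ) :
    #{x ∈ s.biUnion P ×ˢ s.biUnion P | f x.1 = f x.2} ≤
      #s * ∑ i ∈ s, #{x ∈ P i ×ˢ P i | f x.1 = f x.2} := by
  have hU : ∀ x ∈ s.biUnion P, f x ∈ (s.biUnion P).image f := fun x hx => mem_image_of_mem _ hx
  have hi : ∀ i ∈ s, ∀ x ∈ P i, f x ∈ (s.biUnion P).image f := fun i hi x hx =>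
    mem_image_of_mem _ (mem_biUnion.2 ⟨i, hi, hx⟩)
  rw [card_filter_eq_sum_mul_fibers _ _ f f _ hU,
    sum_congr rfl fun i h => card_filter_eq_sum_mul_fibers (P i) (P i) f f _ (hi i h),
    sum_comm, mul_sum]
  refine sum_le_sum fun c _ => ?_
  simp_rw [← sq]
  refine le_trans ?_ sq_sum_le_card_mul_sum_sq
  gcongr
  rw [filter_biUnion]
  exact card_biUnion_le

/-- If `a * b = c * e` amounts to an equality of ratios `d a c = d e b`, the energy of a union of
`m` sets is at most `m ^ 4` times the largest energy of a member. -/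
@[to_additive /-- If `a + b = c + e` amounts to an equality of differences `d a c = d e b`, the
energy of a union of `m` sets is at most `m ^ 4` times the largest energy of a member. -/]
lemma mulEnergy_biUnion_le [Mul α] (d : α → α → γ) (s : Finset ι) (D : ι → Finset α) (M : ℕ)
    (hd : ∀ a ∈ s.biUnion D, ∀ b ∈ s.biUnion D, ∀ c ∈ s.biUnion D, ∀ e ∈ s.biUnion D,
      (a * b = c * e ↔ d a c = d e b))
    (hM : ∀ i ∈ s, mulEnergy (D i) (D i) ≤ M) :
    mulEnergy (s.biUnion D) (s.biUnion D) ≤ #s ^ 4 * M := by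
  have hmem : ∀ i ∈ s, ∀ x ∈ D i, x ∈ s.biUnion D := fun i hi x hx => mem_biUnion.2 ⟨i, hi, hx⟩
  have self1 : ∀ i ∈ s, #{x ∈ (D i ×ˢ D i) ×ˢ (D i ×ˢ D i) | d x.1.1 x.1.2 = d x.2.1 x.2.2} ≤ M := by
    intro i hi
    refine le_trans (card_le_card_of_injOn (fun x => (x.1, x.2.swap)) ?_ ?_) (hM i hi)
    · rintro ⟨⟨a, b⟩, c, e⟩ hx
      simp only [coe_filter, mem_product, Set.mem_ofPred_eq, Prod.swap] at hx ⊢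
      obtain ⟨⟨⟨h1, h2⟩, h3, h4⟩, h5⟩ := hx
      exact ⟨⟨⟨h1, h2⟩, h4, h3⟩, (hd _ (hmem i hi _ h1) _ (hmem i hi _ h4) _ (hmem i hi _ h2) _
        (hmem i hi _ h3)).2 h5⟩
    · rintro ⟨⟨a, b⟩, c, e⟩ - ⟨⟨a', b'⟩, c', e'⟩ - h
      simpa [and_comm] using h
  have self2 : ∀ i ∈ s, #{x ∈ (D i ×ˢ D i) ×ˢ (D i ×ˢ D i) | d x.1.2 x.1.1 = d x.2.2 x.2.1} ≤ M := by
    intro i hi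
    refine le_trans (card_le_card_of_injOn (fun x => (x.1.swap, x.2.swap)) ?_ ?_) (self1 i hi)
    · rintro ⟨⟨a, b⟩, c, e⟩ hx
      simp only [coe_filter, mem_product, Set.mem_ofPred_eq, Prod.swap] at hx ⊢
      tauto
    · rintro ⟨⟨a, b⟩, c, e⟩ - ⟨⟨a', b'⟩, c', e'⟩ - h
      simp only [Prod.swap, Prod.mk.injEq] at h ⊢
      tauto
  have cross : ∀ i ∈ s, ∀ j ∈ s, mulEnergy (D i) (D j) ≤ M := by
    intro i hi j hj
    have h := two_mul_card_cross_le (D i ×ˢ D i) (D j ×ˢ D j) (fun x => d x.1 x.2)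
      (fun x => d x.2 x.1)
    have h1 := self1 i hi
    have h2 := self2 j hj
    have h3 : mulEnergy (D i) (D j) =
        #{x ∈ (D i ×ˢ D i) ×ˢ (D j ×ˢ D j) | d x.1.1 x.1.2 = d x.2.2 x.2.1} := by
      rw [mulEnergy]
      congr 1
      refine filter_congr ?_
      rintro ⟨⟨a, b⟩, c, e⟩ hx
      simp only [mem_product] at hx ⊢
      obtain ⟨⟨h1, h2⟩, h3, h4⟩ := hx
      exact hd _ (hmem i hi _ h1) _ (hmem j hj _ h3) _ (hmem i hi _ h2) _ (hmem j hj _ h4)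
    rw [h3]
    omega
  have hprod : s.biUnion D ×ˢ s.biUnion D = (s ×ˢ s).biUnion fun i => D i.1 ×ˢ D i.2 := by
    ext ⟨x, y⟩
    simp only [mem_product, mem_biUnion, Prod.exists]
    constructor
    · rintro ⟨⟨i, hi, hx⟩, j, hj, hy⟩
      exact ⟨i, j, ⟨hi, hj⟩, hx, hy⟩
    · rintro ⟨i, j, ⟨hi, hj⟩, hx, hy⟩
      exact ⟨⟨i, hi, hx⟩, j, hj, hy⟩
  rw [mulEnergy_eq_card_filter, hprod]
  refine (card_collisions_biUnion_le (s ×ˢ s) (fun i => D i.1 ×ˢ D i.2)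
    (fun x => x.1 * x.2)).trans ?_
  have : ∑ i ∈ s ×ˢ s, #{x ∈ (D i.1 ×ˢ D i.2) ×ˢ (D i.1 ×ˢ D i.2) | x.1.1 * x.1.2 = x.2.1 * x.2.2}
      ≤ #(s ×ˢ s) • M := by
    refine sum_le_card_nsmul _ _ _ fun i hi => ?_
    rw [mem_product] at hi
    rw [← mulEnergy_eq_card_filter]
    exact cross _ hi.1 _ hi.2
  refine (Nat.mul_le_mul_left _ this).trans_eq ?_
  rw [card_product, smul_eq_mul]
  ring

end Energy

section Sumsets

variable {G : Type*} [AddCommGroup G] [DecidableEq G]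

/-- A form of the Plünnecke--Petridis inequality valid on a subset of at least half the size. -/
lemma exists_large_subset_card_add_add_le (A B : Finset G) :
    ∃ A' ⊆ A, #A ≤ 2 * #A' ∧ ∀ C : Finset G, #(A' + B + C) * #A ≤ 2 * #(A + B) * #(A' + C) := by
  obtain hA | hA := A.eq_empty_or_nonempty
  · exact ⟨∅, by simp, by simp [hA]⟩
  obtain hB | hB := B.eq_empty_or_nonempty
  · exact ⟨A, Subset.rfl, by omega, by simp [hB]⟩
  obtain ⟨A', hA', hmax⟩ := exists_max_image A.powerset
    (fun Y => (2 * #(A + B) * #Y : ℤ) - #(Y + B) * #A) ⟨A, by simp⟩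
  rw [mem_powerset] at hA'
  refine ⟨A', hA', ?_, ?_⟩
  · have h := hmax A (by simp)
    have h2 : (0 : ℤ) < #(A + B) := by exact_mod_cast (hA.add hB).card_pos
    have h3 : (0 : ℤ) ≤ #(A' + B) * #A := by positivity
    have h4 : (#(A + B) * #A : ℤ) ≤ #(A + B) * (2 * #A') := by linarith
    exact_mod_cast le_of_mul_le_mul_left h4 h2
  · intro C
    induction C using Finset.induction_on with
    | empty => simp
    | insert c C hc ih =>
      set Z := A'.filter fun a => ∀ b ∈ B, a + b + c ∈ A' + B + C with hZ
      have hZA : Z ⊆ A' := filter_subset _ _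
      have h1 : A' + B + insert c C ⊆
          (A' + B + C) ∪ ((A' + B) \ (Z + B)).image (· + c) := by
        intro x hx
        obtain ⟨y, hy, c', hc', rfl⟩ := mem_add.1 hx
        obtain rfl | hc' := mem_insert.1 hc'
        · by_cases hyZ : y ∈ Z + B
          · obtain ⟨a, ha, b, hb, rfl⟩ := mem_add.1 hyZ
            exact mem_union_left _ ((mem_filter.1 ha).2 b hb)
          · exact mem_union_right _ (mem_image_of_mem _ (mem_sdiff.2 ⟨hy, hyZ⟩))
        · exact mem_union_left _ (add_mem_add hy hc')
      have h2 : (A' + C) ∪ (A' \ Z).image (· + c) ⊆ A' + insert c C := by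
        intro x hx
        obtain hx | hx := mem_union.1 hx
        · obtain ⟨a, ha, c', hc', rfl⟩ := mem_add.1 hx
          exact add_mem_add ha (mem_insert_of_mem hc')
        · obtain ⟨a, ha, rfl⟩ := mem_image.1 hx
          exact add_mem_add (mem_sdiff.1 ha).1 (mem_insert_self _ _)
      have hdisj : Disjoint (A' + C) ((A' \ Z).image (· + c)) := by
        rw [disjoint_right]
        intro x hx hx'
        obtain ⟨a, ha, rfl⟩ := mem_image.1 hx
        obtain ⟨a', ha', c', hc', h⟩ := mem_add.1 hx'
        refine (mem_sdiff.1 ha).2 (mem_filter.2 ⟨(mem_sdiff.1 ha).1, fun b hb => ?_⟩)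
        have : a + b + c = a' + b + c' := by
          rw [add_right_comm, ← h, add_right_comm]
        rw [this]
        exact add_mem_add (add_mem_add ha' hb) hc'
      have h1c := (card_le_card h1).trans (card_union_le _ _)
      have h2c := card_le_card h2
      rw [card_union_of_disjoint hdisj, card_image_of_injective _ (add_left_injective c)] at h2c
      rw [card_image_of_injective _ (add_left_injective c)] at h1c
      have h3 := card_sdiff_add_card_eq_card hZA
      have h4 := card_sdiff_add_card_eq_card (add_subset_add_right hZA : Z + B ⊆ A' + B)
      have h5 := hmax Z (mem_powerset.2 (hZA.trans hA'))
      zify at *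
      have h6 : (#(A' + B + insert c C) : ℤ) * #A ≤
          (#(A' + B + C) + (#(A' + B) - #(Z + B))) * #A := by
        gcongr; linarith
      have h7 : (2 * #(A + B) : ℤ) * (#(A' + C) + (#A' - #Z)) ≤
          2 * #(A + B) * #(A' + insert c C) := by
        gcongr; linarith
      linarith

/-- A positive proportion of `X` is covered by few translates of `Y`. -/
lemma exists_translates_cover (X Y : Finset G) (hX : X.Nonempty) (hY : Y.Nonempty) :
    ∃ S : Finset G, 8 * #(X \ (S + Y)) ≤ #X ∧ #S * #Y ≤ 8 * #(X - Y) := by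
  obtain ⟨S, hS, hmax⟩ := exists_max_image (X - Y).powerset
    (fun S => (8 * #(X - Y) * #(X ∩ (S + Y)) : ℤ) - #X * #Y * #S) ⟨∅, by simp⟩
  have hXY := (hX.sub hY).card_pos
  refine ⟨S, ?_, ?_⟩
  · by_contra! hlt
    set R := X \ (S + Y) with hR
    have hR0 : 0 < #R := by
      have := hX.card_pos
      omega
    obtain ⟨t, ht, hfib⟩ : ∃ t ∈ X - Y,
        #R * #Y ≤ #(X - Y) * #{z ∈ R ×ˢ Y | z.1 - z.2 = t} := by
      by_contra! hcon
      have hmap : ∀ z ∈ R ×ˢ Y, z.1 - z.2 ∈ X - Y := fun z hz =>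
        sub_mem_sub (mem_sdiff.1 (mem_product.1 hz).1).1 (mem_product.1 hz).2
      have h1 := card_eq_sum_card_fiberwise hmap
      have h2 : ∑ t ∈ X - Y, #(X - Y) * #{z ∈ R ×ˢ Y | z.1 - z.2 = t} <
          ∑ t ∈ X - Y, #R * #Y := sum_lt_sum_of_nonempty (hX.sub hY) hcon
      rw [← mul_sum, ← h1, card_product, sum_const, smul_eq_mul] at h2
      exact lt_irrefl _ h2
    have hdisj : Disjoint (X ∩ (S + Y)) ({z ∈ R ×ˢ Y | z.1 - z.2 = t}.image Prod.fst) := by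
      rw [disjoint_right]
      intro x hx hx'
      obtain ⟨z, hz, rfl⟩ := mem_image.1 hx
      exact (mem_sdiff.1 (mem_product.1 (mem_filter.1 hz).1).1).2 (mem_inter.1 hx').2
    have hsub : (X ∩ (S + Y)) ∪ ({z ∈ R ×ˢ Y | z.1 - z.2 = t}.image Prod.fst) ⊆
        X ∩ (insert t S + Y) := by
      intro x hx
      obtain hx | hx := mem_union.1 hx
      · exact inter_subset_inter_left (add_subset_add_right (subset_insert _ _)) hx
      · obtain ⟨⟨x, y⟩, hz, rfl⟩ := mem_image.1 hx
        simp only [mem_filter, mem_product] at hz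
        refine mem_inter.2 ⟨(mem_sdiff.1 hz.1.1).1, mem_add.2 ⟨t, mem_insert_self _ _, y, hz.1.2, ?_⟩⟩
        rw [← hz.2, sub_add_cancel]
    have hinj : Set.InjOn (Prod.fst : G × G → G)
        ({z ∈ R ×ˢ Y | z.1 - z.2 = t} : Finset (G × G)) := by
      rintro ⟨x, y⟩ hz ⟨x', y'⟩ hz' h
      simp only [coe_filter, Set.mem_ofPred_eq] at hz hz' h
      subst h
      rw [Prod.mk.injEq]
      exact ⟨rfl, sub_right_injective (hz.2.trans hz'.2.symm)⟩
    have h1 := card_le_card hsub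
    rw [card_union_of_disjoint hdisj, card_image_of_injOn hinj] at h1
    have h2 := hmax (insert t S) (mem_powerset.2 (insert_subset ht (mem_powerset.1 hS)))
    have h3 : #(insert t S) ≤ #S + 1 := card_insert_le _ _
    have hY0 := hY.card_pos
    zify at *
    have h4 : (8 * #(X - Y) : ℤ) * (#(X ∩ (S + Y)) + #{z ∈ R ×ˢ Y | z.1 - z.2 = t}) ≤
      8 * #(X - Y) * #(X ∩ (insert t S + Y)) := by gcongr
    have h5 : (#X * #Y : ℤ) * #(insert t S) ≤ #X * #Y * (#S + 1) := by gcongr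
    have h6 : (#X : ℤ) * #Y < 8 * #R * #Y := by gcongr
    linarith
  · have h := hmax ∅ (by simp)
    have h1 : #(X ∩ (S + Y)) ≤ #X := card_le_card inter_subset_left
    have hX0 := hX.card_pos
    simp only [empty_add, inter_empty, card_empty] at h
    zify at *
    have h2 : (8 * #(X - Y) : ℤ) * #(X ∩ (S + Y)) ≤ 8 * #(X - Y) * #X := by gcongr
    have h3 : (#X : ℤ) * (#S * #Y) ≤ #X * (8 * #(X - Y)) := by linarith
    exact le_of_mul_le_mul_left h3 hX0

end Sumsets

section BalogSzemerediGowers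

variable {G : Type*} [AddCommGroup G] [DecidableEq G]

/-- `A ∩ (A + d)`. -/
def shiftInter (A : Finset G) (d : G) : Finset G := {a ∈ A | a - d ∈ A}

lemma mem_shiftInter {A : Finset G} {d a : G} : a ∈ shiftInter A d ↔ a ∈ A ∧ a - d ∈ A := by
  simp [shiftInter]

lemma card_fiber_sub (A : Finset G) (d : G) :
    #{x ∈ A ×ˢ A | x.1 - x.2 = d} = #(shiftInter A d) := by
  refine card_nbij' Prod.fst (fun a => (a, a - d)) ?_ ?_ ?_ ?_
  · rintro ⟨a, b⟩ h
    simp only [coe_filter, mem_product, Set.mem_ofPred_eq] at h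
    simp only [mem_coe, mem_shiftInter]
    refine ⟨h.1.1, ?_⟩
    rw [← h.2, sub_sub_cancel]
    exact h.1.2
  · intro a h
    simp only [mem_coe, mem_shiftInter] at h
    simpa using h
  · rintro ⟨a, b⟩ h
    simp only [coe_filter, mem_product, Set.mem_ofPred_eq] at h
    simp [← h.2]
  · intro a h
    rfl

lemma sum_card_shiftInter [Fintype G] (A : Finset G) : ∑ d, #(shiftInter A d) = #A ^ 2 := by
  simp_rw [← card_fiber_sub]
  rw [← card_eq_sum_card_fiberwise (fun _ _ => mem_univ _), card_product, sq]

lemma sum_sq_card_shiftInter [Fintype G] (A : Finset G) :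
    ∑ d, #(shiftInter A d) ^ 2 = addEnergy A A := by
  simp_rw [← card_fiber_sub, sq]
  rw [← card_filter_eq_sum_mul_fibers (A ×ˢ A) (A ×ˢ A) (fun x => x.1 - x.2)
    (fun x => x.1 - x.2) univ (fun _ _ => mem_univ _), addEnergy]
  refine card_equiv ((Equiv.refl _).prodCongr (Equiv.prodComm _ _)) ?_
  rintro ⟨⟨a, b⟩, c, e⟩
  simp only [mem_filter, mem_product, Equiv.prodCongr_apply, Equiv.coe_refl, Prod.map_apply, id_eq,
    Equiv.prodComm_apply, Prod.swap]
  rw [sub_eq_sub_iff_add_eq_add, add_comm c b]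
  tauto

lemma sum_card_pairs_shiftInter [Fintype G] (A : Finset G) (r : G → Prop) [DecidablePred r] :
    ∑ x, #{y ∈ shiftInter A x ×ˢ shiftInter A x | r (y.1 - y.2)} =
      ∑ y ∈ A ×ˢ A with r (y.1 - y.2), #(shiftInter A (y.1 - y.2)) := by
  have h : ∀ x, #{y ∈ shiftInter A x ×ˢ shiftInter A x | r (y.1 - y.2)} =
      ∑ y ∈ A ×ˢ A with r (y.1 - y.2), if y.1 - x ∈ A ∧ y.2 - x ∈ A then 1 else 0 := by
    intro x
    rw [sum_boole, filter_filter, Nat.cast_id]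
    congr 1
    ext ⟨a, b⟩
    simp only [mem_filter, mem_product, mem_shiftInter]
    tauto
  simp_rw [h]
  rw [sum_comm]
  refine sum_congr rfl ?_
  rintro ⟨a, b⟩ -
  rw [sum_boole, Nat.cast_id]
  refine card_nbij' (fun x => a - x) (fun y => a - y) ?_ ?_ ?_ ?_
  · intro x hx
    simp only [coe_filter, mem_univ, true_and, Set.mem_ofPred_eq, mem_coe, mem_shiftInter] at hx ⊢
    refine ⟨hx.1, ?_⟩
    convert hx.2 using 1
    abel
  · intro y hy
    simp only [coe_filter, mem_univ, true_and, Set.mem_ofPred_eq, mem_coe, mem_shiftInter] at hy ⊢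
    refine ⟨by simpa using hy.1, ?_⟩
    convert hy.2 using 1
    abel
  · intro x hx
    simp
  · intro x hx
    simp

/-- Many representations of each difference of `D` as `(x₁ - x₂) - (x₃ - x₄)` bound `D - D`. -/
lemma card_sub_mul_le_of_popular (A D P : Finset G) (t m : ℝ) (ht : 0 ≤ t)
    (hD : ∀ a ∈ D, ∀ b ∈ D, m ≤ #{c ∈ P | t ≤ #(shiftInter A (a - c)) ∧
      t ≤ #(shiftInter A (b - c))}) :
    (#(D - D) : ℝ) * (m * t ^ 2) ≤ #A ^ 4 := by
  have key : ∀ d ∈ D - D, m * t ^ 2 ≤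
      #{q ∈ (A ×ˢ A) ×ˢ (A ×ˢ A) | (q.1.1 - q.1.2) - (q.2.1 - q.2.2) = d} := by
    intro d hd
    obtain ⟨a, ha, b, hb, rfl⟩ := mem_sub.1 hd
    set C := {c ∈ P | t ≤ #(shiftInter A (a - c)) ∧ t ≤ #(shiftInter A (b - c))} with hC
    have h1 : C.biUnion (fun c => {x ∈ A ×ˢ A | x.1 - x.2 = a - c} ×ˢ
        {x ∈ A ×ˢ A | x.1 - x.2 = b - c}) ⊆
        {q ∈ (A ×ˢ A) ×ˢ (A ×ˢ A) | (q.1.1 - q.1.2) - (q.2.1 - q.2.2) = a - b} := by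
      intro q hq
      obtain ⟨c, -, hq⟩ := mem_biUnion.1 hq
      obtain ⟨h1, h2⟩ := mem_product.1 hq
      rw [mem_filter] at h1 h2
      refine mem_filter.2 ⟨mem_product.2 ⟨h1.1, h2.1⟩, ?_⟩
      rw [h1.2, h2.2, sub_sub_sub_cancel_right]
    have h2 : ∑ c ∈ C, (t * t) ≤ (#(C.biUnion (fun c => {x ∈ A ×ˢ A | x.1 - x.2 = a - c} ×ˢ
        {x ∈ A ×ˢ A | x.1 - x.2 = b - c})) : ℝ) := by
      rw [card_biUnion]
      · push_cast
        refine sum_le_sum fun c hc => ?_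
        rw [card_product, card_fiber_sub, card_fiber_sub]
        push_cast
        obtain ⟨-, h1, h2⟩ := mem_filter.1 hc
        gcongr
      · intro c _ c' _ hcc
        refine disjoint_left.2 fun q hq hq' => ?_
        refine hcc ?_
        have e1 := (mem_filter.1 (mem_product.1 hq).1).2
        have e2 := (mem_filter.1 (mem_product.1 hq').1).2
        exact sub_right_injective (e1.symm.trans e2)
    rw [sum_const, nsmul_eq_mul] at h2
    calc m * t ^ 2 ≤ #C * (t * t) := by
          rw [sq]; gcongr; exact hD a ha b hb
      _ ≤ _ := h2
      _ ≤ _ := by exact_mod_cast card_le_card h1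
  calc (#(D - D) : ℝ) * (m * t ^ 2) = ∑ d ∈ D - D, m * t ^ 2 := by simp
    _ ≤ ∑ d ∈ D - D,
        (#{q ∈ (A ×ˢ A) ×ˢ (A ×ˢ A) | (q.1.1 - q.1.2) - (q.2.1 - q.2.2) = d} : ℝ) :=
      sum_le_sum key
    _ ≤ (#((A ×ˢ A) ×ˢ (A ×ˢ A)) : ℝ) := by
      rw [← Nat.cast_sum, sum_card_fiberwise_eq_card_filter]
      exact_mod_cast card_le_card (filter_subset _ _)
    _ = #A ^ 4 := by
      simp only [card_product]
      push_cast
      ring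

/-- A **Balog--Szemerédi--Gowers** theorem with polynomial dependence, following Schoen. -/
theorem exists_subset_card_sub_le_of_le_addEnergy [Fintype G] (A : Finset G) (T : ℝ) (hT : 0 < T)
    (hE : T ≤ addEnergy A A) :
    ∃ D ⊆ A, T ≤ 4 * (#A : ℝ) ^ 2 * #D ∧ (#(D - D) : ℝ) * T ^ 3 ≤ 1024 * (#A : ℝ) ^ 10 := by
  have hA : A.Nonempty := by
    by_contra! h
    simp [h] at hE
    linarith
  have hA0 : (0 : ℝ) < #A := by exact_mod_cast hA.card_pos
  set t : ℝ := T / (16 * (#A : ℝ) ^ 2) with ht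
  have ht0 : 0 < t := by positivity
  have htA : 16 * t * (#A : ℝ) ^ 2 = T := by rw [ht]; field_simp
  let bad : G → ℕ := fun x =>
    #{y ∈ shiftInter A x ×ˢ shiftInter A x | (#(shiftInter A (y.1 - y.2)) : ℝ) < t}
  have hbad : ∑ x, (bad x : ℝ) ≤ t * (#A : ℝ) ^ 2 := by
    rw [← Nat.cast_sum]
    simp only [bad]
    rw [sum_card_pairs_shiftInter A (fun d => (#(shiftInter A d) : ℝ) < t)]
    push_cast
    calc _ ≤ ∑ y ∈ A ×ˢ A with (#(shiftInter A (y.1 - y.2)) : ℝ) < t, t :=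
          sum_le_sum fun y hy => (mem_filter.1 hy).2.le
      _ ≤ ∑ y ∈ A ×ˢ A, t := sum_le_sum_of_subset_of_nonneg (filter_subset _ _)
          fun _ _ _ => ht0.le
      _ = t * (#A : ℝ) ^ 2 := by
          rw [sum_const, card_product, nsmul_eq_mul]; push_cast; ring
  obtain ⟨x, hne, hx⟩ : ∃ x, (shiftInter A x).Nonempty ∧
      T * #(shiftInter A x) + 16 * (#A : ℝ) ^ 2 * bad x ≤
        2 * (#A : ℝ) ^ 2 * (#(shiftInter A x) : ℝ) ^ 2 := by
    by_contra! hcon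
    have hlt : ∑ x, 2 * (#A : ℝ) ^ 2 * (#(shiftInter A x) : ℝ) ^ 2 <
        ∑ x, (T * #(shiftInter A x) + 16 * (#A : ℝ) ^ 2 * bad x) := by
      refine sum_lt_sum (fun x _ => ?_) ⟨0, mem_univ _, hcon 0 ?_⟩
      · obtain h | h := (shiftInter A x).eq_empty_or_nonempty
        · rw [h]
          simp only [card_empty, Nat.cast_zero]
          have : (0 : ℝ) ≤ bad x := Nat.cast_nonneg _
          simp only [ne_eq, OfNat.ofNat_ne_zero, not_false_eq_true, zero_pow, mul_zero, zero_add]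
          positivity
        · exact (hcon x h).le
      · obtain ⟨a, ha⟩ := hA
        exact ⟨a, mem_shiftInter.2 ⟨ha, by simpa using ha⟩⟩
    rw [sum_add_distrib, ← mul_sum, ← mul_sum, ← mul_sum] at hlt
    have e1 : ∑ x, (#(shiftInter A x) : ℝ) = (#A : ℝ) ^ 2 := by
      exact_mod_cast sum_card_shiftInter A
    have e2 : ∑ x, (#(shiftInter A x) : ℝ) ^ 2 = addEnergy A A := by
      exact_mod_cast sum_sq_card_shiftInter A
    rw [e1, e2] at hlt
    have e3 : (#A : ℝ) ^ 2 * (16 * ∑ x, (bad x : ℝ)) ≤ (#A : ℝ) ^ 2 * T := by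
      gcongr
      linarith
    have e4 : (#A : ℝ) ^ 2 * T ≤ (#A : ℝ) ^ 2 * addEnergy A A := by gcongr
    linarith
  set P := shiftInter A x with hP
  have hP0 : (0 : ℝ) < #P := by exact_mod_cast hne.card_pos
  have hbx : (0 : ℝ) ≤ bad x := Nat.cast_nonneg _
  have hTP : T ≤ 2 * (#A : ℝ) ^ 2 * #P := by
    refine le_of_mul_le_mul_right ?_ hP0
    have : 0 ≤ 16 * (#A : ℝ) ^ 2 * bad x := by positivity
    linarith
  have hbadx : 8 * (bad x : ℝ) ≤ (#P : ℝ) ^ 2 := by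
    have h1 : 0 ≤ T * #P := by positivity
    have h2 : (2 * (#A : ℝ) ^ 2) * (8 * bad x) ≤ 2 * (#A : ℝ) ^ 2 * (#P : ℝ) ^ 2 := by linarith
    exact le_of_mul_le_mul_left h2 (by positivity)
  let deg : G → ℕ := fun a => #{b ∈ P | (#(shiftInter A (a - b)) : ℝ) < t}
  have hdeg : ∑ a ∈ P, deg a = bad x := by
    simp only [bad, deg, card_filter]
    rw [sum_product]
  set D := {a ∈ P | 4 * deg a ≤ #P} with hD
  have hDP : #P ≤ 2 * #D := by
    have h1 : #(P \ D) * #P ≤ 4 * bad x := by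
      rw [← hdeg, mul_sum]
      calc #(P \ D) * #P = ∑ a ∈ P \ D, #P := by simp
        _ ≤ ∑ a ∈ P \ D, 4 * deg a := by
          refine sum_le_sum fun a ha => ?_
          simp only [hD, mem_sdiff, mem_filter, not_and, not_le] at ha
          exact (ha.2 ha.1).le
        _ ≤ _ := sum_le_sum_of_subset sdiff_subset
    have h2 : #(P \ D) + #D = #P := card_sdiff_add_card_eq_card (filter_subset _ _)
    have h3 : 8 * bad x ≤ #P ^ 2 := by exact_mod_cast hbadx
    have h4 : #P * (2 * #(P \ D)) ≤ #P * #P := by nlinarith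
    have := Nat.le_of_mul_le_mul_left h4 hne.card_pos
    omega
  refine ⟨D, (filter_subset _ _).trans (filter_subset _ _), ?_, ?_⟩
  · have : (#P : ℝ) ≤ 2 * #D := by exact_mod_cast hDP
    calc T ≤ 2 * (#A : ℝ) ^ 2 * #P := hTP
      _ ≤ 2 * (#A : ℝ) ^ 2 * (2 * #D) := by gcongr
      _ = _ := by ring
  · have h := card_sub_mul_le_of_popular A D P t (#P / 2) ht0.le ?_
    · calc (#(D - D) : ℝ) * T ^ 3 = #(D - D) * (T * (16 * t * (#A : ℝ) ^ 2) ^ 2) := by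
            rw [htA]; ring
        _ ≤ #(D - D) * ((2 * (#A : ℝ) ^ 2 * #P) * (16 * t * (#A : ℝ) ^ 2) ^ 2) := by gcongr
        _ = 1024 * (#A : ℝ) ^ 6 * (#(D - D) * (#P / 2 * t ^ 2)) := by ring
        _ ≤ 1024 * (#A : ℝ) ^ 6 * (#A : ℝ) ^ 4 := by gcongr
        _ = _ := by ring
    · intro a ha b hb
      have ha' := (mem_filter.1 ha).2
      have hb' := (mem_filter.1 hb).2
      have hcov : P ⊆ ({c ∈ P | t ≤ #(shiftInter A (a - c)) ∧ t ≤ #(shiftInter A (b - c))} ∪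
          {c ∈ P | (#(shiftInter A (a - c)) : ℝ) < t}) ∪
          {c ∈ P | (#(shiftInter A (b - c)) : ℝ) < t} := by
        intro c hc
        simp only [mem_union, mem_filter, hc, true_and]
        rcases lt_or_ge (#(shiftInter A (a - c)) : ℝ) t with h | h
        · exact Or.inl (Or.inr h)
        · rcases lt_or_ge (#(shiftInter A (b - c)) : ℝ) t with h' | h'
          · exact Or.inr h'
          · exact Or.inl (Or.inl ⟨h, h'⟩)
      have h1 := (card_le_card hcov).trans
        ((card_union_le _ _).trans (Nat.add_le_add_right (card_union_le _ _) _))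
      have h2 : #P ≤ 2 * #{c ∈ P | t ≤ #(shiftInter A (a - c)) ∧
          t ≤ #(shiftInter A (b - c))} := by
        simp only [deg] at ha' hb'
        omega
      rw [div_le_iff₀ two_pos, mul_comm]
      exact_mod_cast h2

end BalogSzemerediGowers

section Dilates

variable {F : Type*} [Field F] [DecidableEq F]

lemma mulEnergy_eq_sum_card_dilate (A : Finset F) (hA : (0 : F) ∉ A) :
    mulEnergy A A = ∑ b ∈ A, ∑ x ∈ A, #{a ∈ A | x * a ∈ b • A} := by
  rw [mulEnergy, card_filter, sum_product, sum_product_right]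
  refine sum_congr rfl fun b hb => sum_congr rfl fun x _ => ?_
  have hb0 : b ≠ 0 := fun h => hA (h ▸ hb)
  rw [← card_filter]
  refine card_nbij Prod.fst ?_ ?_ ?_
  · rintro ⟨a, c⟩ h
    simp only [coe_filter, mem_product, Set.mem_ofPred_eq] at h ⊢
    refine ⟨h.1.1, ?_⟩
    rw [h.2, ← smul_eq_mul]
    exact smul_mem_smul_finset h.1.2
  · rintro ⟨a, c⟩ h ⟨a', c'⟩ h' e
    simp only [coe_filter, mem_product, Set.mem_ofPred_eq] at h h' e
    subst e
    rw [Prod.mk.injEq]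
    exact ⟨rfl, mul_left_cancel₀ hb0 (h.2.symm.trans h'.2)⟩
  · intro a h
    simp only [coe_filter, Set.mem_ofPred_eq] at h
    obtain ⟨c, hc, e⟩ := mem_smul_finset.1 h.2
    exact ⟨(a, c), by simpa [h.1, hc] using e.symm, rfl⟩

/-- Many dilates `x • A` have a large intersection with one fixed dilate `b • A`. -/
lemma exists_pivot_dilate (A : Finset F) (hA : (0 : F) ∉ A) (hne : A.Nonempty) (h : ℝ)
    (hh : 0 ≤ h) (hE : 2 * (#A : ℝ) ^ 2 * h = mulEnergy A A) :
    ∃ b ∈ A, ∃ X ⊆ A, h ≤ #X ∧ ∀ x ∈ X, h ≤ #{a ∈ A | x * a ∈ b • A} := by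
  have hn : (0 : ℝ) < #A := by exact_mod_cast hne.card_pos
  obtain ⟨b, hb, hsum⟩ : ∃ b ∈ A, 2 * #A * h ≤ ∑ x ∈ A, (#{a ∈ A | x * a ∈ b • A} : ℝ) := by
    by_contra! hcon
    have h1 := sum_lt_sum_of_nonempty hne hcon
    rw [sum_const, nsmul_eq_mul] at h1
    have h2 : ((mulEnergy A A : ℕ) : ℝ) = ∑ b ∈ A, ∑ x ∈ A, (#{a ∈ A | x * a ∈ b • A} : ℝ) := by
      rw [mulEnergy_eq_sum_card_dilate A hA]; push_cast; rfl
    rw [← h2, ← hE] at h1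
    exact lt_irrefl _ (h1.trans_le (le_of_eq (by ring)))
  refine ⟨b, hb, {x ∈ A | h ≤ #{a ∈ A | x * a ∈ b • A}}, filter_subset _ _, ?_,
    fun x hx => (mem_filter.1 hx).2⟩
  rw [← sum_filter_add_sum_filter_not A (fun x => h ≤ #{a ∈ A | x * a ∈ b • A})] at hsum
  have h1 : ∑ x ∈ A with h ≤ #{a ∈ A | x * a ∈ b • A}, (#{a ∈ A | x * a ∈ b • A} : ℝ) ≤
      #{x ∈ A | h ≤ #{a ∈ A | x * a ∈ b • A}} * #A := by
    rw [← nsmul_eq_mul]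
    refine sum_le_card_nsmul _ _ _ fun x _ => ?_
    exact_mod_cast card_le_card (filter_subset _ _)
  have h2 : ∑ x ∈ A with ¬ h ≤ #{a ∈ A | x * a ∈ b • A}, (#{a ∈ A | x * a ∈ b • A} : ℝ) ≤
      #A * h := by
    calc _ ≤ ∑ x ∈ A with ¬ h ≤ #{a ∈ A | x * a ∈ b • A}, h :=
          sum_le_sum fun x hx => (not_le.1 (mem_filter.1 hx).2).le
      _ ≤ ∑ x ∈ A, h := sum_le_sum_of_subset_of_nonneg (filter_subset _ _) fun _ _ _ => hh
      _ = _ := by simp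
  refine le_of_mul_le_mul_right ?_ hn
  linarith

lemma exists_translates_cover_dilate {A X : Finset F} (hXA : X ⊆ A) (hX : X.Nonempty) (b x : F)
    {h : ℝ} (hh : 0 < h) (hx : h ≤ #{a ∈ A | x * a ∈ b • A}) :
    ∃ X' ⊆ X, ∃ S : Finset F, 8 * #(X \ X') ≤ #X ∧ x • X' ⊆ S + b • A ∧
      #S * h ≤ 8 * #(A - A) := by
  set Y := {a ∈ A | x * a ∈ b • A} with hYdef
  have hY : Y.Nonempty := by
    rw [← card_pos]
    exact_mod_cast hh.trans_le hx
  obtain ⟨S, hS1, hS2⟩ := exists_translates_cover X Y hX hY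
  refine ⟨X ∩ (S + Y), inter_subset_left, x • S, by simpa using hS1, ?_, ?_⟩
  · intro z hz
    obtain ⟨w, hw, rfl⟩ := mem_smul_finset.1 hz
    obtain ⟨s, hs, y, hy, rfl⟩ := mem_add.1 (mem_inter.1 hw).2
    rw [smul_add]
    exact add_mem_add (smul_mem_smul_finset hs) (mem_filter.1 hy).2
  · have h1 : #(x • S) ≤ #S := card_image_le
    have h2 : #(X - Y) ≤ #(A - A) := card_le_card (sub_subset_sub hXA (filter_subset _ _))
    have h3 : (#S * #Y : ℝ) ≤ 8 * #(X - Y) := by exact_mod_cast hS2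
    calc (#(x • S) : ℝ) * h ≤ #S * #Y := by gcongr
      _ ≤ 8 * #(X - Y) := h3
      _ ≤ 8 * #(A - A) := by gcongr

/-- For `ξ` a ratio of differences of elements of `X`, the set `Y + ξ • Y` is small for a large
subset `Y` of `X`. -/
lemma exists_large_subset_card_add_dilate_le {A X : Finset F} (hXA : X ⊆ A) (hX : X.Nonempty)
    (b : F) {h : ℝ} (hh : 0 < h) (hpop : ∀ x ∈ X, h ≤ #{a ∈ A | x * a ∈ b • A})
    {ξ x₁ x₂ x₃ x₄ : F} (h₁ : x₁ ∈ X) (h₂ : x₂ ∈ X) (h₃ : x₃ ∈ X) (h₄ : x₄ ∈ X) (hne : x₃ ≠ x₄)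
    (hξ : ξ * (x₃ - x₄) = x₁ - x₂) :
    ∃ Y ⊆ X, #X ≤ 2 * #Y ∧
      #(Y + ξ • Y) * h ^ 4 ≤ (8 * #(A - A) : ℝ) ^ 4 * #((A + A) - (A + A)) := by
  obtain ⟨X₁, hX₁, S₁, hs₁, hc₁, hb₁⟩ := exists_translates_cover_dilate hXA hX b x₁ hh (hpop _ h₁)
  obtain ⟨X₂, hX₂, S₂, hs₂, hc₂, hb₂⟩ := exists_translates_cover_dilate hXA hX b x₂ hh (hpop _ h₂)
  obtain ⟨X₃, hX₃, S₃, hs₃, hc₃, hb₃⟩ := exists_translates_cover_dilate hXA hX b x₃ hh (hpop _ h₃)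
  obtain ⟨X₄, hX₄, S₄, hs₄, hc₄, hb₄⟩ := exists_translates_cover_dilate hXA hX b x₄ hh (hpop _ h₄)
  set Y := (X₁ ∩ X₂) ∩ (X₃ ∩ X₄) with hY
  have hYX : Y ⊆ X := inter_subset_left.trans (inter_subset_left.trans hX₁)
  refine ⟨Y, hYX, ?_, ?_⟩
  · have hcov : X \ Y ⊆ ((X \ X₁) ∪ (X \ X₂)) ∪ ((X \ X₃) ∪ (X \ X₄)) := by
      intro x hx
      simp only [hY, mem_sdiff, mem_union, mem_inter] at hx ⊢
      tauto
    have e1 := card_le_card hcov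
    have e2 := card_union_le ((X \ X₁) ∪ (X \ X₂)) ((X \ X₃) ∪ (X \ X₄))
    have e3 := card_union_le (X \ X₁) (X \ X₂)
    have e4 := card_union_le (X \ X₃) (X \ X₄)
    have e5 := card_sdiff_add_card_eq_card hYX
    omega
  · have hsub : (x₃ - x₄) • (Y + ξ • Y) ⊆
        ((S₁ - S₂) + (S₃ - S₄)) + b • ((A + A) - (A + A)) := by
      intro z hz
      obtain ⟨w, hw, rfl⟩ := mem_smul_finset.1 hz
      obtain ⟨y, hy, w', hw', rfl⟩ := mem_add.1 hw
      obtain ⟨y', hy', rfl⟩ := mem_smul_finset.1 hw'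
      simp only [hY, mem_inter] at hy hy'
      obtain ⟨s₁, hs₁, u₁, hu₁, e₁⟩ := mem_add.1 (hc₁ (smul_mem_smul_finset hy'.1.1))
      obtain ⟨s₂, hs₂, u₂, hu₂, e₂⟩ := mem_add.1 (hc₂ (smul_mem_smul_finset hy'.1.2))
      obtain ⟨s₃, hs₃, u₃, hu₃, e₃⟩ := mem_add.1 (hc₃ (smul_mem_smul_finset hy.2.1))
      obtain ⟨s₄, hs₄, u₄, hu₄, e₄⟩ := mem_add.1 (hc₄ (smul_mem_smul_finset hy.2.2))
      obtain ⟨a₁, ha₁, rfl⟩ := mem_smul_finset.1 hu₁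
      obtain ⟨a₂, ha₂, rfl⟩ := mem_smul_finset.1 hu₂
      obtain ⟨a₃, ha₃, rfl⟩ := mem_smul_finset.1 hu₃
      obtain ⟨a₄, ha₄, rfl⟩ := mem_smul_finset.1 hu₄
      refine mem_add.2 ⟨(s₁ - s₂) + (s₃ - s₄),
        add_mem_add (sub_mem_sub hs₁ hs₂) (sub_mem_sub hs₃ hs₄), b • ((a₁ + a₃) - (a₂ + a₄)),
        smul_mem_smul_finset (sub_mem_sub (add_mem_add ha₁ ha₃) (add_mem_add ha₂ ha₄)), ?_⟩
      simp only [smul_eq_mul] at *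
      linear_combination e₁ - e₂ + e₃ - e₄ - y' * hξ
    have hcard : #(Y + ξ • Y) ≤ (#S₁ * #S₂) * (#S₃ * #S₄) * #((A + A) - (A + A)) := by
      rw [← card_smul_finset₀ (sub_ne_zero.2 hne) (Y + ξ • Y)]
      refine (card_le_card hsub).trans (card_add_le.trans ?_)
      refine Nat.mul_le_mul (card_add_le.trans (Nat.mul_le_mul card_sub_le card_sub_le)) ?_
      exact card_image_le
    calc (#(Y + ξ • Y) : ℝ) * h ^ 4
        ≤ ((#S₁ * #S₂) * (#S₃ * #S₄) * #((A + A) - (A + A)) : ℕ) * h ^ 4 := by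
          gcongr
      _ = ((#S₁ * h) * (#S₂ * h)) * ((#S₃ * h) * (#S₄ * h)) * #((A + A) - (A + A)) := by
          push_cast; ring
      _ ≤ ((8 * #(A - A)) * (8 * #(A - A))) * ((8 * #(A - A)) * (8 * #(A - A))) *
            #((A + A) - (A + A)) := by gcongr
      _ = _ := by ring

/-- The ratios of differences of elements of `X`. -/
def IsDiffRatio (X : Finset F) (ξ : F) : Prop :=
  ∃ x₁ ∈ X, ∃ x₂ ∈ X, ∃ x₃ ∈ X, ∃ x₄ ∈ X, x₃ ≠ x₄ ∧ ξ * (x₃ - x₄) = x₁ - x₂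

lemma card_pow_three_le_of_not_isDiffRatio {X Y : Finset F} (hYX : Y ⊆ X) {ξ : F}
    (hξ : ¬ IsDiffRatio X (ξ - 1)) : #Y ^ 3 ≤ 4 * #(Y - Y) * #(Y + ξ • Y) := by
  obtain ⟨Y', hY', hcard, hC⟩ := exists_large_subset_card_add_add_le Y (-Y)
  have hC := hC (ξ • Y)
  have hinj : #Y' * #Y ≤ #(Y' + -Y + ξ • Y) := by
    rw [← card_product]
    refine card_le_card_of_injOn (fun y => y.1 + -y.2 + ξ • y.2) ?_ ?_
    · rintro ⟨y, y'⟩ hy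
      rw [mem_coe, mem_product] at hy
      exact add_mem_add (add_mem_add hy.1 (neg_mem_neg hy.2)) (smul_mem_smul_finset hy.2)
    · rintro ⟨y, y'⟩ hy ⟨z, z'⟩ hz e
      rw [mem_coe, mem_product] at hy hz
      simp only [smul_eq_mul] at e
      have h' : z' = y' := by
        by_contra hne
        refine hξ ⟨y, hYX (hY' hy.1), z, hYX (hY' hz.1), z', hYX hz.2, y', hYX hy.2, hne, ?_⟩
        linear_combination -e
      subst h'
      simpa using e
  have hsub : #(Y' + ξ • Y) ≤ #(Y + ξ • Y) := card_le_card (add_subset_add_right hY')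
  rw [← sub_eq_add_neg Y Y] at hC
  calc #Y ^ 3 = #Y * #Y * #Y := by ring
    _ ≤ 2 * #Y' * #Y * #Y := by gcongr
    _ = 2 * (#Y' * #Y * #Y) := by ring
    _ ≤ 2 * (#(Y' + -Y + ξ • Y) * #Y) := by gcongr
    _ ≤ 2 * (2 * #(Y - Y) * #(Y' + ξ • Y)) := by gcongr
    _ ≤ 2 * (2 * #(Y - Y) * #(Y + ξ • Y)) := by gcongr
    _ = _ := by ring

lemma card_pow_four_le_card_add_dilate_mul (Y : Finset F) (ξ : F) :
    #Y ^ 4 ≤ #(Y + ξ • Y) *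
      #{x ∈ (Y ×ˢ Y) ×ˢ (Y ×ˢ Y) | x.1.1 + ξ * x.1.2 = x.2.1 + ξ * x.2.2} := by
  have hV : ∀ x ∈ Y ×ˢ Y, x.1 + ξ * x.2 ∈ Y + ξ • Y := fun x hx =>
    add_mem_add (mem_product.1 hx).1 (smul_mem_smul_finset (mem_product.1 hx).2)
  rw [card_filter_eq_sum_mul_fibers (Y ×ˢ Y) (Y ×ˢ Y) (fun x => x.1 + ξ * x.2)
    (fun x => x.1 + ξ * x.2) _ hV]
  simp_rw [← sq]
  refine le_trans (le_of_eq ?_) sq_sum_le_card_mul_sum_sq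
  rw [← card_eq_sum_card_fiberwise hV, card_product]
  ring

lemma exists_dilate_few_collisions [Fintype F] (X : Finset F) : ∃ ξ : F, Fintype.card F *
    #{x ∈ (X ×ˢ X) ×ˢ (X ×ˢ X) | x.1.1 + ξ * x.1.2 = x.2.1 + ξ * x.2.2} ≤
      Fintype.card F * #X ^ 2 + #X ^ 4 := by
  by_contra! hcon
  have h1 := sum_lt_sum_of_nonempty (univ_nonempty (α := F)) fun ξ _ => hcon ξ
  rw [← mul_sum, sum_const, smul_eq_mul, card_univ] at h1
  have h2 := Nat.lt_of_mul_lt_mul_left h1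
  refine absurd h2 (not_lt.2 ?_)
  simp_rw [card_filter]
  rw [sum_comm]
  simp_rw [← card_filter]
  have key : ∀ x ∈ (X ×ˢ X) ×ˢ (X ×ˢ X),
      #{ξ : F | x.1.1 + ξ * x.1.2 = x.2.1 + ξ * x.2.2} ≤
        (if x.1 = x.2 then Fintype.card F else 0) + 1 := by
    rintro ⟨⟨a, b⟩, c, d⟩ -
    dsimp only
    split_ifs with h
    · exact (card_le_univ _).trans (Nat.le_succ _)
    · rw [zero_add, card_le_one]
      intro ξ hξ η hη
      simp only [mem_filter, mem_univ, true_and] at hξ hη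
      have hbd : b ≠ d := by
        rintro rfl
        exact h (by simpa using hξ)
      refine mul_right_cancel₀ (sub_ne_zero.2 hbd) ?_
      linear_combination hξ - hη
  refine (sum_le_sum key).trans (le_of_eq ?_)
  rw [sum_add_distrib, ← sum_filter, sum_const, sum_const]
  have : #{x ∈ (X ×ˢ X) ×ˢ (X ×ˢ X) | x.1 = x.2} = #X ^ 2 := by
    rw [sq, ← card_product]
    refine card_nbij' Prod.fst (fun x => (x, x)) ?_ ?_ ?_ ?_
    · rintro ⟨x, y⟩ h
      simp only [coe_filter, mem_product, Set.mem_ofPred_eq] at h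
      simpa using h.1.1
    · intro x h
      simpa using h
    · rintro ⟨x, y⟩ h
      simp only [coe_filter, mem_product, Set.mem_ofPred_eq] at h
      simp [h.2]
    · intro x h
      rfl
  rw [this]
  simp only [card_product, smul_eq_mul]
  ring

end Dilates

section PrimeField

variable {p : ℕ} [Fact p.Prime]

lemma exists_isDiffRatio_or_forall (X : Finset (ZMod p)) (hX : 1 < #X) :
    (∃ ξ, IsDiffRatio X ξ ∧ ¬ IsDiffRatio X (ξ - 1)) ∨ ∀ ξ, IsDiffRatio X ξ := by
  by_contra! hcon
  obtain ⟨hstep, ξ, hξ⟩ := hcon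
  obtain ⟨a, ha, b, hb, hab⟩ := one_lt_card.1 hX
  have h : ∀ n : ℕ, IsDiffRatio X (-(n : ZMod p)) := by
    intro n
    induction n with
    | zero => exact ⟨a, ha, a, ha, a, ha, b, hb, hab, by simp⟩
    | succ n ih =>
      have := hstep _ ih
      rwa [show -(n : ZMod p) - 1 = -((n + 1 : ℕ) : ZMod p) by push_cast; ring] at this
  refine hξ ?_
  have := h (-ξ).val
  rwa [ZMod.natCast_zmod_val, neg_neg] at this

/-- A set with small difference set has small multiplicative energy. -/
theorem mulEnergy_le_of_card_sub_le (A : Finset (ZMod p)) (hA : (0 : ZMod p) ∉ A)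
    (hne : A.Nonempty) (κ : ℝ) (hκ : (#(A - A) : ℝ) ≤ κ * #A) :
    (mulEnergy A A : ℝ) ^ 7 * #A ≤ 2 ^ 24 * κ ^ 9 * (#A : ℝ) ^ 21 ∨
      (mulEnergy A A : ℝ) ^ 7 * p ≤ 2 ^ 24 * κ ^ 9 * (#A : ℝ) ^ 22 := by
  set n : ℝ := (#A : ℝ) with hn
  have hn1 : 1 ≤ n := by
    rw [hn]; exact_mod_cast hne.card_pos
  have hn0 : 0 < n := by linarith
  have hκ1 : 1 ≤ κ := by
    refine le_of_mul_le_mul_right ?_ hn0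
    rw [one_mul]
    refine le_trans ?_ hκ
    rw [hn]
    obtain ⟨a, ha⟩ := hne
    exact_mod_cast card_le_card_of_injOn (fun x => x - a) (fun x hx => sub_mem_sub hx ha)
      (fun x _ y _ h => sub_left_injective h)
  set h : ℝ := mulEnergy A A / (2 * n ^ 2) with hh
  have hE : 2 * n ^ 2 * h = mulEnergy A A := by rw [hh]; field_simp
  have hE0 : (0 : ℝ) < mulEnergy A A := by exact_mod_cast mulEnergy_self_pos hne
  have hh0 : 0 < h := by positivity
  obtain ⟨b, -, X, hXA, hhX, hpop⟩ := exists_pivot_dilate A hA hne h hh0.le hE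
  have hXn : (#X : ℝ) ≤ n := by rw [hn]; exact_mod_cast card_le_card hXA
  have hhn : h ≤ n := hhX.trans hXn
  have hX : X.Nonempty := by
    rw [← card_pos]
    exact_mod_cast hh0.trans_le hhX
  have hW : (#((A + A) - (A + A)) : ℝ) ≤ κ ^ 4 * n := by
    have h1 := pluennecke_ruzsa_inequality_nsmul_sub_nsmul_sub hne A 2 2
    rw [two_nsmul] at h1
    have h2 : (#((A + A) - (A + A)) : ℝ) ≤ (#(A - A) / #A : ℝ) ^ (2 + 2) * #A := by
      have h3 := (NNRat.cast_le (K := ℝ)).2 h1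
      push_cast at h3
      exact h3
    refine h2.trans ?_
    have : (#(A - A) / #A : ℝ) ≤ κ := by rw [div_le_iff₀ hn0]; exact hκ
    gcongr
  have hratio : ∀ ξ, IsDiffRatio X ξ → ∃ Y ⊆ X, #X ≤ 2 * #Y ∧
      #(Y + ξ • Y) * h ^ 4 ≤ 2 ^ 12 * κ ^ 8 * n ^ 5 := by
    rintro ξ ⟨x₁, h₁, x₂, h₂, x₃, h₃, x₄, h₄, hne, hξ⟩
    obtain ⟨Y, hYX, hcard, hY⟩ := exists_large_subset_card_add_dilate_le hXA hX b hh0 hpop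
      h₁ h₂ h₃ h₄ hne hξ
    refine ⟨Y, hYX, hcard, hY.trans ?_⟩
    calc (8 * #(A - A) : ℝ) ^ 4 * #((A + A) - (A + A)) ≤ (8 * (κ * n)) ^ 4 * (κ ^ 4 * n) := by
          gcongr
      _ = _ := by ring
  have hE7 : (mulEnergy A A : ℝ) ^ 7 = 2 ^ 7 * n ^ 14 * h ^ 7 := by rw [← hE]; ring
  rw [hE7]
  obtain hX1 | hX1 := le_or_gt #X 1
  · left
    have hh1 : h ≤ 1 := hhX.trans (by exact_mod_cast hX1)
    calc 2 ^ 7 * n ^ 14 * h ^ 7 * n ≤ 2 ^ 7 * n ^ 14 * 1 ^ 7 * n := by gcongr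
      _ = 2 ^ 7 * 1 ^ 9 * n ^ 15 := by ring
      _ ≤ 2 ^ 24 * κ ^ 9 * n ^ 21 := by
        gcongr <;> norm_num
  obtain ⟨ξ, hξ, hξ'⟩ | hall := exists_isDiffRatio_or_forall X hX1
  · left
    obtain ⟨Y, hYX, hcard, hY⟩ := hratio ξ hξ
    have h1 : (#Y : ℝ) ^ 3 ≤ 4 * #(Y - Y) * #(Y + ξ • Y) := by
      exact_mod_cast card_pow_three_le_of_not_isDiffRatio hYX hξ'
    have h2 : (#(Y - Y) : ℝ) ≤ κ * n := le_trans (by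
      exact_mod_cast card_le_card (sub_subset_sub (hYX.trans hXA) (hYX.trans hXA))) hκ
    have h3 : h ≤ 2 * #Y := hhX.trans (by exact_mod_cast hcard)
    have h4 : h ^ 7 ≤ 2 ^ 17 * κ ^ 9 * n ^ 6 := by
      calc h ^ 7 = h ^ 3 * h ^ 4 := by ring
        _ ≤ (2 * #Y) ^ 3 * h ^ 4 := by gcongr
        _ = 8 * (#Y ^ 3 * h ^ 4) := by ring
        _ ≤ 8 * (4 * #(Y - Y) * #(Y + ξ • Y) * h ^ 4) := by gcongr
        _ = 32 * #(Y - Y) * (#(Y + ξ • Y) * h ^ 4) := by ring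
        _ ≤ 32 * (κ * n) * (2 ^ 12 * κ ^ 8 * n ^ 5) := by gcongr
        _ = _ := by ring
    calc 2 ^ 7 * n ^ 14 * h ^ 7 * n ≤ 2 ^ 7 * n ^ 14 * (2 ^ 17 * κ ^ 9 * n ^ 6) * n := by gcongr
      _ = _ := by ring
  · obtain ⟨ξ, hξ⟩ := exists_dilate_few_collisions X
    rw [ZMod.card] at hξ
    obtain ⟨Y, hYX, hcard, hY⟩ := hratio ξ (hall ξ)
    set W : ℝ := (#(Y + ξ • Y) : ℝ) with hWdef
    have hp0 : (0 : ℝ) < p := by exact_mod_cast (Fact.out : p.Prime).pos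
    have hX0 : (0 : ℝ) < #X := by exact_mod_cast hX.card_pos
    have hmain : (p : ℝ) * (#X : ℝ) ^ 2 ≤ 16 * W * (p + (#X : ℝ) ^ 2) := by
      have h1 := card_pow_four_le_card_add_dilate_mul Y ξ
      have h2 : #{x ∈ (Y ×ˢ Y) ×ˢ (Y ×ˢ Y) | x.1.1 + ξ * x.1.2 = x.2.1 + ξ * x.2.2} ≤
          #{x ∈ (X ×ˢ X) ×ˢ (X ×ˢ X) | x.1.1 + ξ * x.1.2 = x.2.1 + ξ * x.2.2} := by
        gcongr
      have h3 : p * #X ^ 4 ≤ 16 * #(Y + ξ • Y) * (p * #X ^ 2 + #X ^ 4) := by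
        calc p * #X ^ 4 ≤ p * (2 * #Y) ^ 4 := by gcongr
          _ = 16 * p * #Y ^ 4 := by ring
          _ ≤ 16 * p * (#(Y + ξ • Y) *
            #{x ∈ (X ×ˢ X) ×ˢ (X ×ˢ X) | x.1.1 + ξ * x.1.2 = x.2.1 + ξ * x.2.2}) := by
              gcongr; exact h1.trans (by gcongr)
          _ = 16 * #(Y + ξ • Y) * (p *
            #{x ∈ (X ×ˢ X) ×ˢ (X ×ˢ X) | x.1.1 + ξ * x.1.2 = x.2.1 + ξ * x.2.2}) := by ring
          _ ≤ _ := by gcongr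
      have h4 : (p : ℝ) * (#X : ℝ) ^ 4 ≤ 16 * W * (p * (#X : ℝ) ^ 2 + (#X : ℝ) ^ 4) := by
        rw [hWdef]; exact_mod_cast h3
      have h5 : (#X : ℝ) ^ 2 * (p * (#X : ℝ) ^ 2) ≤
          (#X : ℝ) ^ 2 * (16 * W * (p + (#X : ℝ) ^ 2)) := by linarith
      exact le_of_mul_le_mul_left h5 (by positivity)
    have hW0 : 0 ≤ W := Nat.cast_nonneg _
    obtain hc | hc := le_total ((#X : ℝ) ^ 2) p
    · left
      have h1 : (#X : ℝ) ^ 2 ≤ 32 * W := by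
        refine le_of_mul_le_mul_left ?_ hp0
        have : 16 * W * (p + (#X : ℝ) ^ 2) ≤ 16 * W * (p + p) := by gcongr
        linarith
      have h4 : h ^ 7 ≤ 2 ^ 17 * κ ^ 9 * n ^ 6 := by
        calc h ^ 7 = h * h ^ 2 * h ^ 4 := by ring
          _ ≤ n * (#X : ℝ) ^ 2 * h ^ 4 := by gcongr
          _ ≤ n * (32 * W) * h ^ 4 := by gcongr
          _ = 32 * n * (W * h ^ 4) := by ring
          _ ≤ 32 * n * (2 ^ 12 * κ ^ 8 * n ^ 5) := by gcongr
          _ = 2 ^ 17 * κ ^ 8 * n ^ 6 := by ring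
          _ ≤ _ := by gcongr; norm_num
      calc 2 ^ 7 * n ^ 14 * h ^ 7 * n ≤ 2 ^ 7 * n ^ 14 * (2 ^ 17 * κ ^ 9 * n ^ 6) * n := by gcongr
        _ = _ := by ring
    · right
      have h1 : (p : ℝ) ≤ 32 * W := by
        refine le_of_mul_le_mul_right ?_ (show (0 : ℝ) < (#X : ℝ) ^ 2 by positivity)
        have : 16 * W * (p + (#X : ℝ) ^ 2) ≤ 16 * W * ((#X : ℝ) ^ 2 + (#X : ℝ) ^ 2) := by gcongr
        linarith
      calc 2 ^ 7 * n ^ 14 * h ^ 7 * p = 2 ^ 7 * n ^ 14 * h ^ 3 * (h ^ 4 * p) := by ring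
        _ ≤ 2 ^ 7 * n ^ 14 * n ^ 3 * (h ^ 4 * (32 * W)) := by gcongr
        _ = 2 ^ 12 * n ^ 17 * (W * h ^ 4) := by ring
        _ ≤ 2 ^ 12 * n ^ 17 * (2 ^ 12 * κ ^ 8 * n ^ 5) := by gcongr
        _ = 2 ^ 24 * κ ^ 8 * n ^ 22 := by ring
        _ ≤ _ := by gcongr; norm_num

end PrimeField

section Decomposition

/-- Removing additively structured subsets of a fixed size `q` until the additive energy drops
below `T`. -/
lemma exists_structured_decomposition {G : Type*} [AddCommGroup G] [Fintype G] [DecidableEq G]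
    (N T : ℝ) (hT : 0 < T) (q : ℕ) (hq : 0 < q)
    (hqT : ∀ m : ℕ, T ≤ 4 * N ^ 2 * m → q ≤ m) (X : Finset G) (hX : (#X : ℝ) ≤ N) :
    ∃ s : Finset (Finset G), (∀ D ∈ s, D ⊆ X ∧ #D = q ∧ (#(D - D) : ℝ) * T ^ 3 ≤ 1024 * N ^ 10) ∧
      (s : Set (Finset G)).PairwiseDisjoint id ∧
      (addEnergy (X \ s.biUnion id) (X \ s.biUnion id) : ℝ) ≤ T := by
  induction X using Finset.strongInduction with
  | H X ih =>
    obtain hE | hE := le_total (addEnergy X X : ℝ) T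
    · exact ⟨∅, by simp, by simp, by simpa using hE⟩
    obtain ⟨D₀, hD₀, hcard, hsub⟩ := exists_subset_card_sub_le_of_le_addEnergy X T hT hE
    obtain ⟨D, hD, hDq⟩ := exists_subset_card_eq (hqT #D₀ (hcard.trans (by gcongr)))
    have hDX := hD.trans hD₀
    have hDne : D.Nonempty := card_pos.1 (hDq ▸ hq)
    obtain ⟨s, hs, hdisj, hsE⟩ := ih (X \ D) (sdiff_ssubset hDX hDne)
      (le_trans (by exact_mod_cast card_le_card sdiff_subset) hX)
    refine ⟨insert D s, ?_, ?_, ?_⟩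
    · intro D' hD'
      obtain rfl | hD' := mem_insert.1 hD'
      · refine ⟨hDX, hDq, ?_⟩
        have h1 : #(D' - D') ≤ #(D₀ - D₀) := card_le_card (sub_subset_sub hD hD)
        calc (#(D' - D') : ℝ) * T ^ 3 ≤ #(D₀ - D₀) * T ^ 3 := by gcongr
          _ ≤ 1024 * (#X : ℝ) ^ 10 := hsub
          _ ≤ _ := by gcongr
      · exact ⟨(hs D' hD').1.trans sdiff_subset, (hs D' hD').2⟩
    · rw [coe_insert]
      refine hdisj.insert fun D' hD' _ => ?_
      exact disjoint_sdiff.mono_right (hs D' hD').1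
    · rwa [biUnion_insert, id, ← sup_eq_union, ← sdiff_sdiff_left]

variable {p : ℕ} [Fact p.Prime]

/-- Decomposition of a set of residues into a part of small additive energy and a part of small
multiplicative energy. -/
theorem exists_low_energy_decomposition (A : Finset (ZMod p)) (hA : A.Nonempty) (K : ℝ)
    (hK : 1 ≤ K) (hKA : K ^ 51 ≤ #A) (hKp : K ^ 51 * #A ≤ p) :
    ∃ B C : Finset (ZMod p), Disjoint B C ∧ A = B ∪ C ∧
      (addEnergy B B : ℝ) * K ≤ 2 ^ 22 * (#A : ℝ) ^ 3 ∧
      (mulEnergy C C : ℝ) * K ≤ 2 ^ 22 * (#A : ℝ) ^ 3 := by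
  set N : ℝ := (#A : ℝ) with hN
  have hN1 : 1 ≤ N := by rw [hN]; exact_mod_cast hA.card_pos
  have hN0 : 0 < N := by linarith
  have hK0 : 0 < K := by linarith
  have hp0 : (0 : ℝ) < p := by exact_mod_cast (Fact.out : p.Prime).pos
  have hKN : K ≤ N := (le_self_pow₀ hK (by norm_num)).trans hKA
  set T : ℝ := N ^ 3 / K with hT
  have hTK : T * K = N ^ 3 := by rw [hT]; field_simp
  have hT0 : 0 < T := by positivity
  have hT1 : 1 ≤ T := by
    rw [hT, le_div_iff₀ hK0, one_mul]
    exact hKN.trans (le_self_pow₀ hN1 (by norm_num))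
  set q : ℕ := ⌈N / (4 * K)⌉₊ with hq
  have hqN : N ≤ 4 * K * q := by
    have := Nat.le_ceil (N / (4 * K))
    rw [div_le_iff₀ (by positivity)] at this
    rw [mul_comm]
    exact this
  have hq0 : 0 < q := Nat.ceil_pos.2 (by positivity)
  have hqR : (0 : ℝ) < q := by exact_mod_cast hq0
  have hqT : ∀ m : ℕ, T ≤ 4 * N ^ 2 * m → q ≤ m := by
    intro m hm
    rw [hq, Nat.ceil_le, div_le_iff₀ (by positivity)]
    refine le_of_mul_le_mul_left ?_ (show 0 < N ^ 2 by positivity)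
    have : T * K ≤ 4 * N ^ 2 * m * K := by gcongr
    rw [hTK] at this
    linarith
  have hX : (#(A.erase 0) : ℝ) ≤ N := by
    rw [hN]; exact_mod_cast card_le_card (erase_subset _ _)
  obtain ⟨s, hs, hdisj, hsE⟩ := exists_structured_decomposition N T hT0 q hq0 hqT (A.erase 0) hX
  set C := s.biUnion id with hC
  have hCX : C ⊆ A.erase 0 := biUnion_subset.2 fun D hD => (hs D hD).1
  have hC0 : (0 : ZMod p) ∉ C := fun h => by simpa using hCX h
  have hCA : C ⊆ A := hCX.trans (erase_subset _ _)
  refine ⟨A \ C, C, sdiff_disjoint, (sdiff_union_of_subset hCA).symm, ?_, ?_⟩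
  · have hcov : A \ C ⊆ (univ : Finset Bool).biUnion
        fun i => if i then A.erase 0 \ C else {(0 : ZMod p)} := by
      intro x hx
      rw [mem_sdiff] at hx
      simp only [mem_biUnion, mem_univ, true_and, Bool.exists_bool]
      by_cases h0 : x = 0
      · left; simp [h0]
      · right; simp [h0, hx]
    have hM : ∀ i ∈ (univ : Finset Bool),
        addEnergy (if i then A.erase 0 \ C else {(0 : ZMod p)})
          (if i then A.erase 0 \ C else {(0 : ZMod p)}) ≤ ⌊T⌋₊ := by
      rintro (_ | _) -
      · rw [Nat.le_floor_iff hT0.le]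
        simpa [addEnergy, filter_singleton] using hT1
      · rw [Nat.le_floor_iff hT0.le]
        simpa using hsE
    have h1 := (addEnergy_mono hcov hcov).trans (addEnergy_biUnion_le (fun a b : ZMod p => a - b)
      univ _ ⌊T⌋₊ (fun a _ b _ c _ e _ => by
        rw [sub_eq_sub_iff_add_eq_add, add_comm c e]) hM)
    have h2 : (addEnergy (A \ C) (A \ C) : ℝ) ≤ 2 ^ 4 * T := by
      calc (addEnergy (A \ C) (A \ C) : ℝ) ≤ (2 ^ 4 * ⌊T⌋₊ : ℕ) := by exact_mod_cast h1
        _ = 2 ^ 4 * (⌊T⌋₊ : ℝ) := by push_cast; norm_num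
        _ ≤ _ := by gcongr; exact Nat.floor_le hT0.le
    calc (addEnergy (A \ C) (A \ C) : ℝ) * K ≤ 2 ^ 4 * T * K := by gcongr
      _ = 2 ^ 4 * N ^ 3 := by rw [mul_assoc, hTK]
      _ ≤ _ := by gcongr <;> norm_num
  · obtain hs0 | hs0 := s.eq_empty_or_nonempty
    · simp only [hC, hs0, biUnion_empty, mulEnergy_empty_left, Nat.cast_zero, zero_mul]
      positivity
    obtain ⟨D, hDs, hmax⟩ := exists_max_image s (fun D => mulEnergy D D) hs0
    obtain ⟨hDX, hDq, hDD⟩ := hs D hDs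
    have hCs : mulEnergy C C ≤ #s ^ 4 * mulEnergy D D := by
      refine mulEnergy_biUnion_le (fun a b : ZMod p => a / b) s id _ ?_ hmax
      intro a _ b hb c hc e _
      have hb0 : b ≠ 0 := fun h => hC0 (h ▸ hb)
      have hc0 : c ≠ 0 := fun h => hC0 (h ▸ hc)
      rw [div_eq_div_iff hc0 hb0, mul_comm c e]
    have hsq : (#s : ℝ) * q ≤ N := by
      have h1 : #C = #s * q := by
        rw [hC, card_biUnion hdisj]
        exact sum_const_nat fun D hD => (hs D hD).2.1
      rw [hN]
      exact_mod_cast h1 ▸ card_le_card hCA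
    have hqA : (q : ℝ) ≤ N := by
      rw [← hDq, hN]
      exact_mod_cast card_le_card (hDX.trans (erase_subset _ _))
    have hDD' : (#(D - D) : ℝ) ≤ 2 ^ 12 * K ^ 4 * (#D : ℝ) := by
      rw [hDq]
      refine le_of_mul_le_mul_right ?_ (show 0 < T ^ 3 by positivity)
      refine hDD.trans ?_
      refine le_of_mul_le_mul_right ?_ (show 0 < K ^ 3 by positivity)
      calc 1024 * N ^ 10 * K ^ 3 = 1024 * (K ^ 3 * N ^ 9) * N := by ring
        _ ≤ 1024 * (K ^ 3 * N ^ 9) * (4 * K * q) := by gcongr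
        _ = 2 ^ 12 * K ^ 4 * q * (N ^ 3) ^ 3 := by ring
        _ = _ := by rw [← hTK]; ring
    have hDne : D.Nonempty := card_pos.1 (hDq ▸ hq0)
    set E : ℝ := (mulEnergy D D : ℝ) with hE
    set EC : ℝ := (mulEnergy C C : ℝ) with hEC
    have hECE : EC * q ^ 4 ≤ N ^ 4 * E := by
      calc EC * q ^ 4 ≤ ((#s : ℝ) ^ 4 * E) * q ^ 4 := by
            gcongr; rw [hEC, hE]; exact_mod_cast hCs
        _ = ((#s : ℝ) * q) ^ 4 * E := by ring
        _ ≤ _ := by gcongr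
    have hEC7 : EC ^ 7 * q ^ 28 ≤ N ^ 28 * E ^ 7 := by
      calc EC ^ 7 * q ^ 28 = (EC * q ^ 4) ^ 7 := by ring
        _ ≤ (N ^ 4 * E) ^ 7 := by gcongr
        _ = _ := by ring
    have hfinal : (EC * K) ^ 7 ≤ (2 ^ 22 * N ^ 3) ^ 7 := by
      obtain h | h := mulEnergy_le_of_card_sub_le D (fun h => hC0 (mem_biUnion.2 ⟨D, hDs, h⟩)) hDne
        (2 ^ 12 * K ^ 4) hDD'
      · rw [hDq, ← hE] at h
        refine le_of_mul_le_mul_right ?_ (show (0 : ℝ) < q ^ 29 * K ^ 44 by positivity)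
        calc (EC * K) ^ 7 * (q ^ 29 * K ^ 44) = K ^ 51 * (EC ^ 7 * q ^ 28) * q := by ring
          _ ≤ N * (N ^ 28 * E ^ 7) * q := by gcongr
          _ = N ^ 29 * (E ^ 7 * q) := by ring
          _ ≤ N ^ 29 * (2 ^ 24 * (2 ^ 12 * K ^ 4) ^ 9 * q ^ 21) := by gcongr
          _ = 2 ^ 132 * N ^ 21 * K ^ 36 * q ^ 21 * N ^ 8 := by ring
          _ ≤ 2 ^ 132 * N ^ 21 * K ^ 36 * q ^ 21 * (4 * K * q) ^ 8 := by gcongr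
          _ = 2 ^ 148 * (N ^ 21 * q ^ 29 * K ^ 44) := by ring
          _ ≤ 2 ^ 154 * (N ^ 21 * q ^ 29 * K ^ 44) := by gcongr <;> norm_num
          _ = _ := by ring
      · rw [hDq, ← hE] at h
        refine le_of_mul_le_mul_right ?_ (show (0 : ℝ) < q ^ 28 * K ^ 44 * N * p by positivity)
        calc (EC * K) ^ 7 * (q ^ 28 * K ^ 44 * N * p)
            = (K ^ 51 * N) * (EC ^ 7 * q ^ 28) * p := by ring
          _ ≤ p * (N ^ 28 * E ^ 7) * p := by gcongr
          _ = N ^ 28 * p * (E ^ 7 * p) := by ring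
          _ ≤ N ^ 28 * p * (2 ^ 24 * (2 ^ 12 * K ^ 4) ^ 9 * q ^ 22) := by gcongr
          _ = 2 ^ 132 * N ^ 22 * K ^ 36 * q ^ 22 * p * N ^ 6 := by ring
          _ ≤ 2 ^ 132 * N ^ 22 * K ^ 36 * q ^ 22 * p * (4 * K * q) ^ 6 := by gcongr
          _ = 2 ^ 144 * (N ^ 22 * q ^ 28 * K ^ 42 * p) := by ring
          _ ≤ 2 ^ 154 * (N ^ 22 * q ^ 28 * K ^ 44 * p) := by gcongr <;> norm_num
          _ = _ := by ring
    exact le_of_pow_le_pow_left₀ (by norm_num) (by positivity) hfinal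

theorem exists_low_energy_decomposition_of_lt_sqrt (A : Finset (ZMod p)) (hA2 : 2 ≤ #A)
    (hAp : (#A : ℝ) < Real.sqrt p) :
    ∃ B C : Finset (ZMod p), Disjoint B C ∧ A = B ∪ C ∧
      max (addEnergy B B : ℝ) (mulEnergy C C : ℝ) ≤
        2 ^ 22 * (Real.log 2 ^ (1 + (4 / 227) / 2 : ℝ))⁻¹ * ((#A : ℝ) ^ (3 - 4 / 227 : ℝ) *
          Real.log #A ^ (1 + (4 / 227) / 2 : ℝ)) := by
  have hl2 : 0 < Real.log 2 := Real.log_pos one_lt_two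
  set c : ℝ := Real.log 2 ^ (1 + (4 / 227) / 2 : ℝ) with hc
  have hc0 : 0 < c := Real.rpow_pos_of_pos hl2 _
  have hN2 : (2 : ℝ) ≤ #A := by exact_mod_cast hA2
  have hN0 : (0 : ℝ) < #A := by linarith
  have hNp : (#A : ℝ) * #A ≤ p := by
    rw [← Real.sq_sqrt (Nat.cast_nonneg p), sq]
    gcongr
  set k : ℝ := (#A : ℝ) ^ (1 / 51 : ℝ) with hk
  have hk0 : 0 < k := by positivity
  have hk51 : k ^ 51 = #A := by
    rw [hk, ← Real.rpow_natCast, ← Real.rpow_mul hN0.le]; norm_num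
  have hk1 : 1 ≤ k := Real.one_le_rpow (by linarith) (by norm_num)
  obtain ⟨B, C, hdisj, hun, hB, hC⟩ := exists_low_energy_decomposition A (card_pos.1 (by omega))
    k hk1 hk51.le (by rw [hk51]; exact hNp)
  refine ⟨B, C, hdisj, hun, ?_⟩
  have hpow : (#A : ℝ) ^ 3 ≤ (#A : ℝ) ^ (3 - 4 / 227 : ℝ) * k := by
    rw [hk, ← Real.rpow_add hN0, ← Real.rpow_natCast]
    exact Real.rpow_le_rpow_of_exponent_le (by linarith) (by norm_num)
  have hlog : 1 ≤ c⁻¹ * Real.log #A ^ (1 + (4 / 227) / 2 : ℝ) := by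
    rw [inv_mul_eq_div, one_le_div₀ hc0]
    exact Real.rpow_le_rpow hl2.le (Real.log_le_log two_pos hN2) (by norm_num)
  have hlog0 : 0 ≤ Real.log #A ^ (1 + (4 / 227) / 2 : ℝ) :=
    Real.rpow_nonneg (Real.log_nonneg (by linarith)) _
  have key : ∀ E : ℝ, E * k ≤ 2 ^ 22 * (#A : ℝ) ^ 3 → E ≤ 2 ^ 22 * c⁻¹ *
      ((#A : ℝ) ^ (3 - 4 / 227 : ℝ) * Real.log #A ^ (1 + (4 / 227) / 2 : ℝ)) := by
    intro E hE
    have h1 : E ≤ 2 ^ 22 * (#A : ℝ) ^ (3 - 4 / 227 : ℝ) := by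
      refine le_of_mul_le_mul_right (hE.trans ?_) hk0
      rw [mul_assoc]
      gcongr
    calc E ≤ 2 ^ 22 * (#A : ℝ) ^ (3 - 4 / 227 : ℝ) * 1 := by rwa [mul_one]
      _ ≤ 2 ^ 22 * (#A : ℝ) ^ (3 - 4 / 227 : ℝ) *
          (c⁻¹ * Real.log #A ^ (1 + (4 / 227) / 2 : ℝ)) := by gcongr
      _ = _ := by ring
  exact max_le (key _ hB) (key _ hC)

theorem exists_low_energy_decomposition_of_sqrt_le (hp : 9 ≤ p) (A : Finset (ZMod p))
    (hAp : Real.sqrt p ≤ #A) :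
    ∃ B C : Finset (ZMod p), Disjoint B C ∧ A = B ∪ C ∧
      max (addEnergy B B : ℝ) (mulEnergy C C : ℝ) ≤
        2 ^ 22 * ((#A : ℝ) ^ 3 * ((#A : ℝ) / p) ^ (4 / 283 : ℝ) *
          Real.log #A ^ (223 / 249 : ℝ)) := by
  have hp9 : (9 : ℝ) ≤ p := by exact_mod_cast hp
  have hp0 : (0 : ℝ) < p := by linarith
  have hN3 : (3 : ℝ) ≤ #A := by
    refine le_trans ?_ hAp
    exact Real.le_sqrt_of_sq_le (by linarith)
  have hN0 : (0 : ℝ) < #A := by linarith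
  have hNp : (p : ℝ) ≤ #A * #A := by
    rw [← Real.sq_sqrt (Nat.cast_nonneg p), sq]
    gcongr
  have hAle : (#A : ℝ) ≤ p := by
    have := card_le_univ A
    rw [ZMod.card] at this
    exact_mod_cast this
  set r : ℝ := (p : ℝ) / #A with hr
  have hr1 : 1 ≤ r := by rw [hr, le_div_iff₀ hN0, one_mul]; exact hAle
  have hr0 : 0 < r := by linarith
  set k : ℝ := r ^ (1 / 51 : ℝ) with hk
  have hk0 : 0 < k := by positivity
  have hk51 : k ^ 51 = r := by
    rw [hk, ← Real.rpow_natCast, ← Real.rpow_mul hr0.le]; norm_num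
  have hk1 : 1 ≤ k := Real.one_le_rpow hr1 (by norm_num)
  obtain ⟨B, C, hdisj, hun, hB, hC⟩ := exists_low_energy_decomposition A
    (card_pos.1 (by exact_mod_cast hN0)) k hk1
    (by rw [hk51, hr, div_le_iff₀ hN0]; exact hNp)
    (by rw [hk51, hr, div_mul_cancel₀ _ hN0.ne'])
  refine ⟨B, C, hdisj, hun, ?_⟩
  have hpow : 1 ≤ ((#A : ℝ) / p) ^ (4 / 283 : ℝ) * k := by
    rw [← inv_div, ← hr, Real.inv_rpow hr0.le, ← Real.rpow_neg hr0.le, hk, ← Real.rpow_add hr0]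
    exact Real.one_le_rpow hr1 (by norm_num)
  have hlog : 1 ≤ Real.log #A ^ (223 / 249 : ℝ) := by
    refine Real.one_le_rpow ?_ (by norm_num)
    rw [Real.le_log_iff_exp_le hN0]
    exact (Real.exp_one_lt_d9.le.trans (by norm_num)).trans hN3
  have key : ∀ E : ℝ, E * k ≤ 2 ^ 22 * (#A : ℝ) ^ 3 → E ≤ 2 ^ 22 *
      ((#A : ℝ) ^ 3 * ((#A : ℝ) / p) ^ (4 / 283 : ℝ) * Real.log #A ^ (223 / 249 : ℝ)) := by
    intro E hE
    have h1 : E ≤ 2 ^ 22 * ((#A : ℝ) ^ 3 * ((#A : ℝ) / p) ^ (4 / 283 : ℝ)) := by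
      refine le_of_mul_le_mul_right (hE.trans ?_) hk0
      calc 2 ^ 22 * (#A : ℝ) ^ 3 = 2 ^ 22 * (#A : ℝ) ^ 3 * 1 := by ring
        _ ≤ 2 ^ 22 * (#A : ℝ) ^ 3 * (((#A : ℝ) / p) ^ (4 / 283 : ℝ) * k) := by gcongr
        _ = _ := by ring
    calc E ≤ 2 ^ 22 * ((#A : ℝ) ^ 3 * ((#A : ℝ) / p) ^ (4 / 283 : ℝ) * 1) := by
          simpa using h1
      _ ≤ _ := by gcongr
  exact max_le (key _ hB) (key _ hC)

end Decomposition

end LowEnergyDecomposition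

theorem theorem4p2 :
    ∃ K : ℝ, 0 < K ∧ ∃ p₀ : ℕ, ∀ (p : ℕ) [Fact p.Prime], p₀ ≤ p →
      ∀ A : Finset (ZMod p),
        (2 ≤ A.card → (A.card : ℝ) < Real.sqrt (p : ℝ) →
          ∃ B C : Finset (ZMod p), Disjoint B C ∧ A = B ∪ C ∧
            max (Finset.addEnergy B B : ℝ) (Finset.mulEnergy C C : ℝ) ≤
              K * ((A.card : ℝ) ^ (3 - 4 / 227 : ℝ) *
                Real.log (A.card : ℝ) ^ (1 + (4 / 227) / 2 : ℝ))) ∧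
        (Real.sqrt (p : ℝ) ≤ (A.card : ℝ) →
          ∃ B C : Finset (ZMod p), Disjoint B C ∧ A = B ∪ C ∧
            max (Finset.addEnergy B B : ℝ) (Finset.mulEnergy C C : ℝ) ≤
              K * ((A.card : ℝ) ^ 3 * ((A.card : ℝ) / (p : ℝ)) ^ (4 / 283 : ℝ) *
                Real.log (A.card : ℝ) ^ (223 / 249 : ℝ))) := by
  set c : ℝ := 2 ^ 22 * (Real.log 2 ^ (1 + (4 / 227) / 2 : ℝ))⁻¹ with hc
  refine ⟨max c (2 ^ 22), by positivity, 9, fun p _ hp A => ⟨fun hA2 hAp => ?_, fun hAp => ?_⟩⟩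
  · obtain ⟨B, C, hdisj, hun, hE⟩ := exists_low_energy_decomposition_of_lt_sqrt A hA2 hAp
    refine ⟨B, C, hdisj, hun, hE.trans ?_⟩
    have : 0 ≤ Real.log (A.card : ℝ) := Real.log_natCast_nonneg _
    gcongr
    exact le_max_left _ _
  · obtain ⟨B, C, hdisj, hun, hE⟩ := exists_low_energy_decomposition_of_sqrt_le hp A hAp
    refine ⟨B, C, hdisj, hun, hE.trans ?_⟩
    have : 0 ≤ Real.log (A.card : ℝ) := Real.log_natCast_nonneg _
    gcongr
    exact le_max_right _ _
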